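/- Let $n\ge 0$ be an integer, let $\mathcal K^n$ be the set of convex bodies in $\mathbb R^n$ (nonempty compact convex subsets), and let $B$ be the closed Euclidean unit ball. Consider maps $V:\mathcal K^n\to\mathbb R$, and call $V$ - a valuation if $V(K\cup L)+V(K\cap L)=V(K)+V(L)$ for all $K,L\in\mathcal K^n$ with $K\cup L\in\mathcal K^n$; - weakly additive if, for every hyperplane $H$ with closed half-spaces $H^+,H^-$, one has $V(K)+V(K\cap H)=V(K\cap H^+)+V(K\cap H^-)$ whenever $K,\,K\cap H,\,K\cap H^+,\,K\cap H^-\in\mathcal K^n$; - translation invariant if $V(K+x)=V(K)$ for all $K\in\mathcal K^n$, $x\in\mathbb R^n$; - $n$-homogeneous if $V(\lambda K)=\lambda^nV(K)$ for all $K\in\mathcal K^n$ and all real $\lambda\ge0$, and $n$-homogeneous with respect to $\mathbb Q$ if this holds for all rational $\lambda\ge0$ (with $0^0=1$); - bounded on $\mathcal K(B)$ if $\sup\{|V(K)|:K\in\mathcal K^n,\ K\subset B\}<\infty$. Then: 1. Every valuation on $\mathcal K^n$ is weakly additive. 2. If $V$ is weakly additive, translation invariant, $n$-homogeneous and bounded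 on $\mathcal K(B)$, then $V$ is proportional to Lebesgue measure: there is $c\in\mathbb R$ with $V(K)=c\,\mathrm{Vol}(K)$ for all $K\in\mathcal K^n$, where $\mathrm{Vol}$ is Lebesgue measure on $\mathbb R^n$. 3. The conclusion of (2) also holds if $V$ is only assumed to be $n$-homogeneous with respect to $\mathbb Q$ instead of $n$-homogeneous. -/

import Mathlib

/-- Points of Euclidean `n`-space. -/
abbrev Eucl (n : ℕ) : Type := EuclideanSpace ℝ (Fin n)

/-- `𝒦ⁿ`: the nonempty compact convex subsets of Euclidean `n`-space. -/
abbrev Bodies (n : ℕ) : Type := ConvexBody (Eucl n)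

namespace BodyFunctional

open scoped Pointwise

variable {n : ℕ}

/-- `V` is a valuation: `V(K ∪ L) + V(K ∩ L) = V(K) + V(L)` whenever `K ∪ L` is a convex body.
Here `U` and `I` are the bodies `K ∪ L` and `K ∩ L`; the intersection is automatically a
(nonempty) convex body when the union is one, since a convex set is connected. -/
def IsValuation (V : Bodies n → ℝ) : Prop :=
  ∀ K L U I : Bodies n,
    (U : Set (Eucl n)) = (K : Set (Eucl n)) ∪ (L : Set (Eucl n)) →
    (I : Set (Eucl n)) = (K : Set (Eucl n)) ∩ (L : Set (Eucl n)) →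
    V U + V I = V K + V L

/-- `V` is weakly additive: `V(K) + V(K ∩ H) = V(K ∩ H⁺) + V(K ∩ H⁻)` for every hyperplane
`H = {x | ⟪u, x⟫ = a}`, `u ≠ 0`, with closed half-spaces `H⁺` and `H⁻`, whenever the four sets
are convex bodies. The bodies `K₀`, `Kp`, `Km` are `K ∩ H`, `K ∩ H⁺`, `K ∩ H⁻`. -/
def IsWeaklyAdditive (V : Bodies n → ℝ) : Prop :=
  ∀ (u : Eucl n) (a : ℝ), u ≠ 0 → ∀ K K₀ Kp Km : Bodies n,
    (K₀ : Set (Eucl n)) = (K : Set (Eucl n)) ∩ {x | inner ℝ u x = a} →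
    (Kp : Set (Eucl n)) = (K : Set (Eucl n)) ∩ {x | a ≤ inner ℝ u x} →
    (Km : Set (Eucl n)) = (K : Set (Eucl n)) ∩ {x | inner ℝ u x ≤ a} →
    V K + V K₀ = V Kp + V Km

/-- `V(K + x) = V(K)` for every body `K` and every vector `x`; here `L` is the body `K + x`. -/
def IsTranslationInvariant (V : Bodies n → ℝ) : Prop :=
  ∀ (x : Eucl n) (K L : Bodies n),
    (L : Set (Eucl n)) = (fun y => y + x) '' (K : Set (Eucl n)) → V L = V K

/-- `V(r K) = r ^ m V(K)` for every real `r ≥ 0`, where `r K = {r y | y ∈ K}`. -/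
def IsHomogeneous (m : ℕ) (V : Bodies n → ℝ) : Prop :=
  ∀ r : ℝ, 0 ≤ r → ∀ K : Bodies n, V (r • K) = r ^ m * V K

/-- `V(q K) = q ^ m V(K)` for every rational `q ≥ 0`. -/
def IsRatHomogeneous (m : ℕ) (V : Bodies n → ℝ) : Prop :=
  ∀ q : ℚ, 0 ≤ q → ∀ K : Bodies n, V ((q : ℝ) • K) = (q : ℝ) ^ m * V K

/-- `V` is bounded on the convex bodies contained in the closed Euclidean unit ball. -/
def IsBoundedOnUnitBall (V : Bodies n → ℝ) : Prop :=
  ∃ C : ℝ, ∀ K : Bodies n, (K : Set (Eucl n)) ⊆ Metric.closedBall 0 1 → |V K| ≤ C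

/-- `V` is a constant multiple of Lebesgue measure (which is finite on convex bodies). -/
def IsProportionalToVolume (V : Bodies n → ℝ) : Prop :=
  ∃ c : ℝ, ∀ K : Bodies n, V K = c * (MeasureTheory.volume (K : Set (Eucl n))).toReal

end BodyFunctional

/-!
A weakly additive functional `V` is extended to all subsets of `ℝⁿ` by `0`. On compact convex sets,
possibly empty, the extension satisfies the cut identity for all coordinate hyperplanes, because a
convex set that misses a hyperplane lies on one side of it. Translation invariance, rational
homogeneity and boundedness on the unit ball give `|V(S)| ≤ D q ^ n` for `S` in a cube of rational
side `q`, and `V` agrees with `c · Vol`, where `c = V([0, 1]ⁿ)`, on all these cubes. So it is enough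
that a set function `G`, here `V - c · Vol`, that satisfies the cut identity and the bound, and
vanishes on the empty set and on cubes, vanishes on every compact convex set `K`.

* `G` vanishes on sets in a coordinate hyperplane
  (`IsCutAdditive.eq_zero_of_subset_hyperplane`): cutting along a grid of width `1 / m` produces
  `O(m ^ (n - 1))` pieces, each with `|G| ≤ D / m ^ n`.
* Hence `J ↦ G(K ∩ J)` is an additive function of boxes (`IsCutAdditive.boxAdditive`). Small cubes
  in the interior or in the complement of `K` contribute nothing, and those near the frontier at
  most `D` times their volume. As the frontier of a convex set is a null set, it has an open
  neighbourhood `U` of small volume, and repeated bisection of a large cube yields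
  `|G(K)| ≤ D · Vol(U)` (`IsCutAdditive.eq_zero`).
-/

open MeasureTheory Set Filter Topology

namespace BodyFunctional

variable {n : ℕ}

/-! ### Set functions additive under cuts by coordinate hyperplanes -/

/-- `G(S) + G(S ∩ H) = G(S ∩ H⁺) + G(S ∩ H⁻)` for every compact convex set `S`, possibly empty,
and every coordinate hyperplane `H = {x | x i = a}`. -/
def IsCutAdditive (G : Set (Fin n → ℝ) → ℝ) : Prop :=
  ∀ S, IsCompact S → Convex ℝ S → ∀ (i : Fin n) (a : ℝ),
    G S + G (S ∩ {x | x i = a}) = G (S ∩ {x | a ≤ x i}) + G (S ∩ {x | x i ≤ a})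

/-- `|G(S)| ≤ D q ^ n` for every compact convex set `S` contained in an axis-parallel cube with
rational side length `q > 0`. -/
def IsCubeBounded (D : ℝ) (G : Set (Fin n → ℝ) → ℝ) : Prop :=
  ∀ q : ℚ, 0 < q → ∀ (a : Fin n → ℝ) (S : Set (Fin n → ℝ)), IsCompact S → Convex ℝ S →
    S ⊆ Icc a (fun i => a i + q) → |G S| ≤ D * (q : ℝ) ^ n

lemma isClosed_coord_ge (i : Fin n) (a : ℝ) : IsClosed {x : Fin n → ℝ | a ≤ x i} :=
  isClosed_le continuous_const (continuous_apply i)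

lemma isClosed_coord_le (i : Fin n) (a : ℝ) : IsClosed {x : Fin n → ℝ | x i ≤ a} :=
  isClosed_le (continuous_apply i) continuous_const

lemma isClosed_coord_eq (i : Fin n) (a : ℝ) : IsClosed {x : Fin n → ℝ | x i = a} :=
  isClosed_eq (continuous_apply i) continuous_const

lemma convex_coord_ge (i : Fin n) (a : ℝ) : Convex ℝ {x : Fin n → ℝ | a ≤ x i} :=
  convex_halfSpace_ge (LinearMap.proj (R := ℝ) (φ := fun _ : Fin n => ℝ) i).isLinear a

lemma convex_coord_le (i : Fin n) (a : ℝ) : Convex ℝ {x : Fin n → ℝ | x i ≤ a} :=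
  convex_halfSpace_le (LinearMap.proj (R := ℝ) (φ := fun _ : Fin n => ℝ) i).isLinear a

lemma convex_coord_eq (i : Fin n) (a : ℝ) : Convex ℝ {x : Fin n → ℝ | x i = a} :=
  convex_hyperplane (LinearMap.proj (R := ℝ) (φ := fun _ : Fin n => ℝ) i).isLinear a

/-- Cutting a set of width at most `M h` in direction `i` by parallel hyperplanes produces at most
`M` slabs of width `h` and `M` sections, hence a bound at most `2 M + 1` times larger. -/
lemma IsCutAdditive.abs_le_of_slabs {G : Set (Fin n → ℝ) → ℝ} (hG : IsCutAdditive G)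
    (i : Fin n) {h D : ℝ} (hh : 0 ≤ h) {S : Set (Fin n → ℝ)}
    (hS : ∀ (a : ℝ) (P : Set (Fin n → ℝ)), P ⊆ S → IsCompact P → Convex ℝ P →
      (∀ x ∈ P, a ≤ x i ∧ x i ≤ a + h) → |G P| ≤ D) (M : ℕ) :
    ∀ (a : ℝ) (P : Set (Fin n → ℝ)), P ⊆ S → IsCompact P → Convex ℝ P →
      (∀ x ∈ P, a ≤ x i ∧ x i ≤ a + M * h) → |G P| ≤ (2 * M + 1) * D := by
  induction M with
  | zero =>
    intro a P hPS hPc hPv hP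
    have := hS a P hPS hPc hPv fun x hx =>
      ⟨(hP x hx).1, by simpa using (hP x hx).2.trans (by simpa using hh)⟩
    simpa using this
  | succ M ih =>
    intro a P hPS hPc hPv hP
    set b : ℝ := a + M * h with hb
    have hcut := hG P hPc hPv i b
    have h1 := hS b (P ∩ {x | x i = b}) (inter_subset_left.trans hPS)
      (hPc.inter_right (isClosed_coord_eq i b)) (hPv.inter (convex_coord_eq i b))
      (by rintro x ⟨-, hx⟩; have hx : x i = b := hx; constructor <;> linarith)
    have h2 := hS b (P ∩ {x | b ≤ x i}) (inter_subset_left.trans hPS)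
      (hPc.inter_right (isClosed_coord_ge i b)) (hPv.inter (convex_coord_ge i b))
      (by
        rintro x ⟨hxP, hx⟩
        refine ⟨hx, ?_⟩
        have := (hP x hxP).2
        push_cast at this
        linarith)
    have h3 := ih a (P ∩ {x | x i ≤ b}) (inter_subset_left.trans hPS)
      (hPc.inter_right (isClosed_coord_le i b)) (hPv.inter (convex_coord_le i b))
      (by rintro x ⟨hxP, hx⟩; exact ⟨(hP x hxP).1, hx⟩)
    have heq : G P = G (P ∩ {x | b ≤ x i}) + G (P ∩ {x | x i ≤ b}) - G (P ∩ {x | x i = b}) := by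
      linarith
    rw [abs_le] at h1 h2 h3 ⊢
    push_cast
    constructor <;> linarith [h1.1, h1.2, h2.1, h2.2, h3.1, h3.2]

/-- A set that has width at most `h` except in the directions of `T`, where the width is at most
`M h`, is cut into at most `(2 M + 1) ^ |T|` pieces that lie in cubes of side `h`. -/
lemma IsCutAdditive.abs_le_of_widths {G : Set (Fin n → ℝ) → ℝ} (hG : IsCutAdditive G)
    {h D : ℝ} (hh : 0 ≤ h)
    (hD : ∀ (a : Fin n → ℝ) (S : Set (Fin n → ℝ)), IsCompact S → Convex ℝ S →
      S ⊆ Icc a (fun i => a i + h) → |G S| ≤ D) (M : ℕ) (T : Finset (Fin n)) :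
    ∀ (a : Fin n → ℝ) (S : Set (Fin n → ℝ)), IsCompact S → Convex ℝ S →
      (∀ x ∈ S, ∀ i, a i ≤ x i ∧ x i ≤ a i + (if i ∈ T then M * h else h)) →
      |G S| ≤ (2 * M + 1) ^ T.card * D := by
  induction T using Finset.induction_on with
  | empty =>
    intro a S hSc hSv hS
    simpa using hD a S hSc hSv fun x hx =>
      ⟨fun i => (hS x hx i).1, fun i => by simpa using (hS x hx i).2⟩
  | insert j T hj ih =>
    intro a S hSc hSv hS
    rw [Finset.card_insert_of_notMem hj, pow_succ', mul_assoc]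
    refine hG.abs_le_of_slabs j hh (S := S) ?_ M (a j) S subset_rfl hSc hSv ?_
    · intro b P hPS hPc hPv hP
      refine ih (Function.update a j b) P hPc hPv fun x hx i => ?_
      by_cases hij : i = j
      · subst hij
        simpa [hj] using hP x hx
      · simpa [hij, Finset.mem_insert] using hS x (hPS hx) i
    · intro x hx
      simpa using hS x hx j

/-- A set in a coordinate hyperplane is covered by `O(m ^ (n - 1))` cubes of side `1 / m`, each of
which contributes `O(m ^ (-n))`. -/
lemma IsCutAdditive.eq_zero_of_subset_hyperplane {G : Set (Fin n → ℝ) → ℝ} (hG : IsCutAdditive G)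
    {D : ℝ} (hD : IsCubeBounded D G) {S : Set (Fin n → ℝ)} (hSc : IsCompact S)
    (hSv : Convex ℝ S) (i : Fin n) (b : ℝ) (hS : ∀ x ∈ S, x i = b) : G S = 0 := by
  obtain ⟨k, rfl⟩ : ∃ k, n = k + 1 := ⟨n - 1, by have := i.pos; omega⟩
  obtain ⟨r, hr⟩ := hSc.isBounded.subset_closedBall 0
  obtain ⟨R, hR⟩ := exists_nat_ge r
  have hcoord : ∀ x ∈ S, ∀ j, -(R : ℝ) ≤ x j ∧ x j ≤ R := fun x hx j => by
    have h1 : ‖x‖ ≤ r := by simpa using hr hx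
    have h2 : |x j| ≤ R := (norm_le_pi_norm x j).trans (h1.trans hR)
    exact abs_le.1 h2
  have hD0 : 0 ≤ D := by
    have := hD 1 one_pos 0 ∅ isCompact_empty convex_empty (empty_subset _)
    simp only [Rat.cast_one, one_pow, mul_one] at this
    exact (abs_nonneg _).trans this
  have key : ∀ m : ℕ, |G S| ≤ ((4 * R + 1) ^ k * D) / ((m : ℝ) + 1) := by
    intro m
    have hm : (0 : ℝ) < (m : ℝ) + 1 := by positivity
    have hq : (0 : ℚ) < 1 / ((m : ℚ) + 1) := by positivity
    have hb := hG.abs_le_of_widths (h := ((1 / ((m : ℚ) + 1) : ℚ) : ℝ))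
      (by exact_mod_cast hq.le) (hD _ hq) (2 * R * (m + 1)) (Finset.univ.erase i)
      (Function.update (fun _ => -(R : ℝ)) i b) S hSc hSv (fun x hx j => by
        by_cases hji : j = i
        · subst hji
          simp only [Function.update_self, hS x hx, le_refl, true_and]
          simp
          positivity
        · have := hcoord x hx j
          simp only [Function.update_of_ne hji, Finset.mem_erase, ne_eq, hji, not_false_eq_true,
            Finset.mem_univ, and_self, if_true]
          refine ⟨this.1, ?_⟩
          have h3 : ((2 * R * (m + 1) : ℕ) : ℝ) * ((1 / ((m : ℚ) + 1) : ℚ) : ℝ) = 2 * R := by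
            push_cast; field_simp
          rw [h3]; linarith [this.2])
    rw [Finset.card_erase_of_mem (Finset.mem_univ i), Finset.card_univ, Fintype.card_fin,
      Nat.add_sub_cancel] at hb
    refine hb.trans ?_
    have h4 : (2 * ((2 * R * (m + 1) : ℕ) : ℝ) + 1) ^ k ≤ ((4 * R + 1) * ((m : ℝ) + 1)) ^ k := by
      apply pow_le_pow_left₀ (by positivity)
      push_cast
      nlinarith [(Nat.cast_nonneg m : (0 : ℝ) ≤ m)]
    calc _ ≤ ((4 * R + 1) * ((m : ℝ) + 1)) ^ k
          * (D * ((1 / ((m : ℚ) + 1) : ℚ) : ℝ) ^ (k + 1)) := by gcongr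
      _ = _ := by
        rw [mul_pow, pow_succ]
        push_cast
        rw [one_div, inv_pow]
        field_simp
  have hlim : Tendsto (fun m : ℕ => ((4 * R + 1 : ℝ) ^ k * D) / ((m : ℝ) + 1)) atTop (𝓝 0) :=
    tendsto_const_nhds.div_atTop (tendsto_natCast_atTop_atTop.atTop_add tendsto_const_nhds)
  exact abs_nonpos_iff.1 (ge_of_tendsto' hlim key)

/-! ### Vanishing of a cut-additive set function that vanishes on cubes -/

open BoxIntegral

/-- The box-additive function `J ↦ G(K ∩ J)`. The sections `K ∩ {x | x i = a}` do not contribute,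
so it does not matter that the boxes of Mathlib are half-open and `G` is evaluated on closed
ones. -/
noncomputable def IsCutAdditive.boxAdditive {G : Set (Fin n → ℝ) → ℝ} (hG : IsCutAdditive G)
    {D : ℝ} (hD : IsCubeBounded D G) {K : Set (Fin n → ℝ)} (hKc : IsCompact K)
    (hKv : Convex ℝ K) : BoxAdditiveMap (Fin n) ℝ ⊤ :=
  BoxAdditiveMap.ofMapSplitAdd (fun J => G (K ∩ Box.Icc J)) ⊤ (by
    intro I _ i x hx
    have hc : IsCompact (K ∩ Box.Icc I) := hKc.inter_right isClosed_Icc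
    have hv : Convex ℝ (K ∩ Box.Icc I) := hKv.inter (convex_Icc _ _)
    have hcut := hG _ hc hv i x
    rw [hG.eq_zero_of_subset_hyperplane hD (hc.inter_right (isClosed_coord_eq i x))
      (hv.inter (convex_coord_eq i x)) i x (fun y hy => hy.2), add_zero] at hcut
    rw [Box.splitLower_def hx, Box.splitUpper_def hx]
    have hlow : Icc I.lower (Function.update I.upper i x) =
        Icc I.lower I.upper ∩ {y | y i ≤ x} := by
      ext y
      simp only [mem_Icc, le_update_iff, mem_inter_iff, mem_ofPred_eq]
      constructor
      · rintro ⟨h1, h2, h3⟩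
        refine ⟨⟨h1, fun j => ?_⟩, h2⟩
        by_cases hj : j = i
        · subst hj; exact h2.trans hx.2.le
        · exact h3 j hj
      · rintro ⟨⟨h1, h2⟩, h3⟩
        exact ⟨h1, h3, fun j _ => h2 j⟩
    have hupp : Icc (Function.update I.lower i x) I.upper =
        Icc I.lower I.upper ∩ {y | x ≤ y i} := by
      ext y
      simp only [mem_Icc, update_le_iff, mem_inter_iff, mem_ofPred_eq]
      constructor
      · rintro ⟨⟨h2, h3⟩, h1⟩
        refine ⟨⟨fun j => ?_, h1⟩, h2⟩
        by_cases hj : j = i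
        · subst hj; exact hx.1.le.trans h2
        · exact h3 j hj
      · rintro ⟨⟨h1, h2⟩, h3⟩
        exact ⟨⟨h3, fun j _ => h1 j⟩, h2⟩
    change G (K ∩ Icc I.lower (Function.update I.upper i x)) +
      G (K ∩ Icc (Function.update I.lower i x) I.upper) = G (K ∩ Icc I.lower I.upper)
    rw [hlow, hupp, ← inter_assoc, ← inter_assoc, add_comm]
    exact hcut.symm)

/-- If `G` also vanishes on cubes, then only small cubes that meet the frontier of `K` contribute
to `G K`; they fit into an open set of arbitrarily small volume, and `|G|` is at most `D` times the
volume on them. -/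
theorem IsCutAdditive.eq_zero {G : Set (Fin n → ℝ) → ℝ} (hG : IsCutAdditive G)
    {D : ℝ} (hD : IsCubeBounded D G) (h0 : G ∅ = 0)
    (hcube : ∀ q : ℚ, 0 < q → ∀ a : Fin n → ℝ, G (Icc a (fun i => a i + q)) = 0)
    {K : Set (Fin n → ℝ)} (hKc : IsCompact K) (hKv : Convex ℝ K) : G K = 0 := by
  obtain ⟨r, hr⟩ := hKc.isBounded.subset_closedBall 0
  obtain ⟨R, hR⟩ := exists_nat_ge r
  have hD0 : 0 ≤ D := by
    have := hD 1 one_pos 0 ∅ isCompact_empty convex_empty (empty_subset _)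
    simp only [Rat.cast_one, one_pow, mul_one] at this
    exact (abs_nonneg _).trans this
  let I : Box (Fin n) :=
    ⟨fun _ => -((R : ℝ) + 1), fun _ => (R : ℝ) + 1, fun _ => by
      have : (0 : ℝ) ≤ R := Nat.cast_nonneg R
      linarith⟩
  have hKI : K ⊆ Box.Icc I := fun x hx => by
    have h1 : ‖x‖ ≤ r := by simpa using hr hx
    have h2 : ∀ j, |x j| ≤ (R : ℝ) + 1 := fun j =>
      (norm_le_pi_norm x j).trans (by linarith)
    exact ⟨fun j => (abs_le.1 (h2 j)).1, fun j => (abs_le.1 (h2 j)).2⟩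
  have key : ∀ ε : ℝ, 0 < ε → |G K| ≤ D * ε := by
    intro ε hε
    obtain ⟨U, hKU, hUo, hU⟩ := (frontier K).exists_isOpen_lt_of_lt (μ := volume)
      (ENNReal.ofReal ε) (by rw [hKv.addHaar_frontier volume]; simpa using hε)
    let f := hG.boxAdditive hD hKc hKv
    let ν := ((volume : Measure (Fin n → ℝ)).restrict U).toBoxAdditive
    have hf : ∀ J, f J = G (K ∩ Box.Icc J) := fun J => rfl
    have hν : ∀ J : Box (Fin n), ν J = volume.real ((J : Set (Fin n → ℝ)) ∩ U) := fun J => by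
      simp only [ν, Measure.toBoxAdditive_apply]
      rw [measureReal_restrict_apply J.measurableSet_coe]
    have hmain : |f I| ≤ D * ν I := by
      refine Box.subbox_induction_on (p := fun J => |f J| ≤ D * ν J) I ?_ ?_
      · intro J _ hJ
        rw [← f.sum_partition_boxes le_top (Prepartition.isPartition_splitCenter J),
          ← ν.sum_partition_boxes le_top (Prepartition.isPartition_splitCenter J),
          Finset.mul_sum]
        exact (Finset.abs_sum_le_sum_abs _ _).trans (Finset.sum_le_sum fun J' hJ' => hJ J' hJ')
      · intro z _
        -- All the small boxes are cubes with a rational side length.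
        have hside : ∀ (J : Box (Fin n)) (m : ℕ),
            (∀ i, J.upper i - J.lower i = (I.upper i - I.lower i) / 2 ^ m) →
            ∃ q : ℚ, 0 < q ∧ J.upper = fun i => J.lower i + (q : ℝ) := by
          intro J m hJ
          refine ⟨2 * (R + 1) / 2 ^ m, by positivity, funext fun i => ?_⟩
          have := hJ i
          simp only [I] at this
          push_cast
          rw [← sub_eq_iff_eq_add', this]
          ring
        have hpos : ∀ J : Box (Fin n), 0 ≤ D * ν J := fun J => by
          rw [hν]; exact mul_nonneg hD0 measureReal_nonneg
        by_cases hzK : z ∈ K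
        · by_cases hzi : z ∈ interior K
          · refine ⟨interior K, mem_nhdsWithin_of_mem_nhds (isOpen_interior.mem_nhds hzi), ?_⟩
            intro J _ m _ hJU hJ
            obtain ⟨q, hq, hqJ⟩ := hside J m hJ
            have : f J = 0 := by
              rw [hf, inter_eq_right.2 (hJU.trans interior_subset), Box.Icc_def, hqJ, hcube q hq]
            simpa [this] using hpos J
          · refine ⟨U, mem_nhdsWithin_of_mem_nhds (hUo.mem_nhds (hKU ?_)), ?_⟩
            · exact ⟨subset_closure hzK, hzi⟩
            intro J _ m _ hJU hJ
            obtain ⟨q, hq, hqJ⟩ := hside J m hJ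
            have hvol : ν J = (q : ℝ) ^ n := by
              rw [hν, inter_eq_left.2 (Box.coe_subset_Icc.trans hJU), measureReal_def,
                Box.volume_apply']
              simp [hqJ]
            rw [hvol, hf]
            refine hD q hq J.lower _ (hKc.inter_right isClosed_Icc) (hKv.inter (convex_Icc _ _)) ?_
            rw [← hqJ]
            exact inter_subset_right
        · refine ⟨Kᶜ, mem_nhdsWithin_of_mem_nhds (hKc.isClosed.isOpen_compl.mem_nhds hzK), ?_⟩
          intro J _ m _ hJU hJ
          have : f J = 0 := by
            rw [hf, disjoint_iff_inter_eq_empty.1 (disjoint_left.2 fun x hx hxJ => hJU hxJ hx), h0]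
          simpa [this] using hpos J
    rw [hf, inter_eq_left.2 hKI] at hmain
    refine hmain.trans (mul_le_mul_of_nonneg_left ?_ hD0)
    rw [hν, measureReal_def]
    exact ENNReal.toReal_le_of_le_ofReal hε.le ((measure_mono inter_subset_right).trans hU.le)
  have hlim : Tendsto (fun m : ℕ => D * (1 / ((m : ℝ) + 1))) atTop (𝓝 (D * 0)) :=
    tendsto_const_nhds.mul tendsto_one_div_add_atTop_nhds_zero_nat
  rw [mul_zero] at hlim
  exact abs_nonpos_iff.1 (ge_of_tendsto' hlim fun m => key _ (by positivity))

/-! ### From functionals on convex bodies to set functions -/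

/-- The functional `V` as a function of subsets of `ℝⁿ` in coordinates; it is set to `0` on sets
that are not convex bodies, in particular on the empty set. -/
noncomputable def toSetFunction (V : Bodies n → ℝ) (S : Set (Fin n → ℝ)) : ℝ :=
  open Classical in
  if h : ∃ K : Bodies n, (K : Set (Eucl n)) = WithLp.ofLp ⁻¹' S then V h.choose else 0

/-- The convex body of `ℝⁿ` that a nonempty compact convex set of coordinate vectors describes. -/
noncomputable def bodyOf (S : Set (Fin n → ℝ)) (hc : IsCompact S) (hv : Convex ℝ S)
    (hne : S.Nonempty) : Bodies n where
  carrier := WithLp.ofLp ⁻¹' S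
  convex' := hv.linear_preimage (EuclideanSpace.equiv (Fin n) ℝ).toLinearMap
  isCompact' := (EuclideanSpace.equiv (Fin n) ℝ).toHomeomorph.isCompact_preimage.2 hc
  nonempty' := hne.preimage (EuclideanSpace.equiv (Fin n) ℝ).surjective

lemma coe_bodyOf (S : Set (Fin n → ℝ)) (hc : IsCompact S) (hv : Convex ℝ S)
    (hne : S.Nonempty) : (bodyOf S hc hv hne : Set (Eucl n)) = WithLp.ofLp ⁻¹' S := rfl

lemma toSetFunction_of_coe_eq (V : Bodies n → ℝ) {S : Set (Fin n → ℝ)} {K : Bodies n}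
    (h : (K : Set (Eucl n)) = WithLp.ofLp ⁻¹' S) : toSetFunction V S = V K := by
  have hex : ∃ K : Bodies n, (K : Set (Eucl n)) = WithLp.ofLp ⁻¹' S := ⟨K, h⟩
  rw [toSetFunction, dif_pos hex]
  exact congrArg V (SetLike.coe_injective (hex.choose_spec.trans h.symm))

lemma toSetFunction_empty (V : Bodies n → ℝ) : toSetFunction V ∅ = 0 := by
  rw [toSetFunction, dif_neg]
  rintro ⟨K, hK⟩
  have := K.nonempty
  rw [hK, preimage_empty] at this
  exact not_nonempty_empty this

lemma IsWeaklyAdditive.isCutAdditive {V : Bodies n → ℝ} (hV : IsWeaklyAdditive V) :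
    IsCutAdditive (toSetFunction V) := by
  intro S hSc hSv i a
  by_cases hne : (S ∩ {x | x i = a}).Nonempty
  · have hnS : S.Nonempty := hne.mono inter_subset_left
    have hnp : (S ∩ {x | a ≤ x i}).Nonempty := hne.mono
      (inter_subset_inter_right _ fun x (hx : x i = a) => hx.ge)
    have hnm : (S ∩ {x | x i ≤ a}).Nonempty := hne.mono
      (inter_subset_inter_right _ fun x (hx : x i = a) => hx.le)
    have hin : ∀ x : Eucl n, inner ℝ (EuclideanSpace.single i (1 : ℝ)) x = x i := fun x => by
      simp [EuclideanSpace.inner_single_left]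
    have hc0 := hSc.inter_right (isClosed_coord_eq i a)
    have hcp := hSc.inter_right (isClosed_coord_ge i a)
    have hcm := hSc.inter_right (isClosed_coord_le i a)
    have hv0 := hSv.inter (convex_coord_eq i a)
    have hvp := hSv.inter (convex_coord_ge i a)
    have hvm := hSv.inter (convex_coord_le i a)
    rw [toSetFunction_of_coe_eq V (coe_bodyOf S hSc hSv hnS),
      toSetFunction_of_coe_eq V (coe_bodyOf _ hc0 hv0 hne),
      toSetFunction_of_coe_eq V (coe_bodyOf _ hcp hvp hnp),
      toSetFunction_of_coe_eq V (coe_bodyOf _ hcm hvm hnm)]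
    refine hV (EuclideanSpace.single i (1 : ℝ)) a (by simp) _ _ _ _ ?_ ?_ ?_ <;>
    · simp only [coe_bodyOf, hin]
      rfl
  · -- A convex set that misses the hyperplane lies on one side of it.
    rw [not_nonempty_iff_eq_empty] at hne
    have hside : (∀ x ∈ S, a ≤ x i) ∧ S ∩ {x | x i ≤ a} = ∅ ∨
        (∀ x ∈ S, x i ≤ a) ∧ S ∩ {x | a ≤ x i} = ∅ := by
      have hno : ∀ x ∈ S, x i ≠ a := fun x hx hxa => by
        have : x ∈ S ∩ {x | x i = a} := ⟨hx, hxa⟩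
        rw [hne] at this
        exact this
      have hpre : IsPreconnected ((fun x : Fin n → ℝ => x i) '' S) :=
        hSv.isPreconnected.image _ (continuous_apply i).continuousOn
      have hord := hpre.ordConnected
      by_cases hex : ∃ y ∈ S, y i < a
      · obtain ⟨y, hy, hya⟩ := hex
        have hall : ∀ x ∈ S, x i < a := by
          intro x hx
          by_contra hxa
          obtain ⟨w, hw, hwa⟩ := hord.out (mem_image_of_mem _ hy) (mem_image_of_mem _ hx)
            ⟨hya.le, not_lt.1 hxa⟩
          exact hno w hw hwa
        right
        refine ⟨fun x hx => (hall x hx).le, ?_⟩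
        rw [eq_empty_iff_forall_notMem]
        rintro x ⟨hx, hxa⟩
        exact absurd (hall x hx) (not_lt.2 hxa)
      · push Not at hex
        left
        refine ⟨hex, ?_⟩
        rw [eq_empty_iff_forall_notMem]
        rintro x ⟨hx, hxa⟩
        exact hno x hx (le_antisymm hxa (hex x hx))
    rw [hne, toSetFunction_empty]
    rcases hside with ⟨h1, h2⟩ | ⟨h1, h2⟩
    · rw [h2, toSetFunction_empty, inter_eq_left.2 (show S ⊆ {x | a ≤ x i} from h1)]
    · rw [h2, toSetFunction_empty, inter_eq_left.2 (show S ⊆ {x | x i ≤ a} from h1), add_comm]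

open scoped Pointwise in
/-- The behaviour under homotheties `x ↦ q x + a` with a rational ratio. -/
lemma IsRatHomogeneous.toSetFunction_image {V : Bodies n → ℝ} (hH : IsRatHomogeneous n V)
    (hT : IsTranslationInvariant V) {q : ℚ} (hq : 0 < q) (a : Fin n → ℝ)
    {S P : Set (Fin n → ℝ)} (hc : IsCompact S) (hv : Convex ℝ S) (hne : S.Nonempty)
    (hP : P = (fun x => (q : ℝ) • x + a) '' S) :
    toSetFunction V P = (q : ℝ) ^ n * toSetFunction V S := by
  have hPc : IsCompact P := by
    rw [hP]; exact hc.image (by fun_prop)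
  have hPv : Convex ℝ P := by
    rw [hP, ← image_image (fun x => x + a) (fun x => (q : ℝ) • x)]
    simpa [add_comm] using (hv.smul (q : ℝ)).translate a
  have hPne : P.Nonempty := by
    rw [hP]; exact hne.image _
  rw [toSetFunction_of_coe_eq V (coe_bodyOf S hc hv hne),
    toSetFunction_of_coe_eq V (coe_bodyOf P hPc hPv hPne), ← hH q hq.le]
  refine hT (WithLp.toLp 2 a) _ _ ?_
  ext x
  simp only [coe_bodyOf, hP, ConvexBody.coe_smul, mem_preimage, mem_image, mem_smul_set]
  constructor
  · rintro ⟨y, hy, hyx⟩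
    refine ⟨(q : ℝ) • WithLp.toLp 2 y, ⟨WithLp.toLp 2 y, hy, rfl⟩, ?_⟩
    ext i
    simpa using congrFun hyx i
  · rintro ⟨y, ⟨z, hz, rfl⟩, rfl⟩
    exact ⟨z.ofLp, hz, rfl⟩

lemma Icc_eq_image_unitCube {q : ℚ} (hq : 0 < q) (a : Fin n → ℝ) :
    Icc a (fun i => a i + q) = (fun x => (q : ℝ) • x + a) '' Icc (0 : Fin n → ℝ) 1 := by
  have hq' : (0 : ℝ) < q := by exact_mod_cast hq
  ext x
  simp only [mem_image, mem_Icc, Pi.le_def]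
  constructor
  · rintro ⟨h1, h2⟩
    refine ⟨fun i => (x i - a i) / q, ⟨fun i => ?_, fun i => ?_⟩, ?_⟩
    · exact div_nonneg (by linarith [h1 i]) hq'.le
    · rw [Pi.one_apply, div_le_one hq']; linarith [h2 i]
    · ext i; simp; field_simp; ring
  · rintro ⟨y, ⟨h1, h2⟩, rfl⟩
    refine ⟨fun i => ?_, fun i => ?_⟩
    · have := mul_nonneg hq'.le (h1 i)
      simpa using this
    · have := mul_le_mul_of_nonneg_left (h2 i) hq'.le
      simp at this ⊢
      linarith

/-- A set in a cube of side `q` is, up to a translation, the image under the dilation with ratio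
`(n + 1) q` of a set in the Euclidean unit ball. -/
lemma IsRatHomogeneous.isCubeBounded {V : Bodies n → ℝ} (hH : IsRatHomogeneous n V)
    (hT : IsTranslationInvariant V) {C : ℝ} (hC0 : 0 ≤ C)
    (hC : ∀ K : Bodies n, (K : Set (Eucl n)) ⊆ Metric.closedBall 0 1 → |V K| ≤ C) :
    IsCubeBounded (((n : ℝ) + 1) ^ n * C) (toSetFunction V) := by
  intro q hq a S hc hv hS
  rcases S.eq_empty_or_nonempty with rfl | hne
  · rw [toSetFunction_empty, abs_zero]
    positivity
  have hq' : (0 : ℝ) < q := by exact_mod_cast hq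
  set t : ℚ := ((n : ℚ) + 1) * q with ht
  have ht0 : 0 < t := by positivity
  have ht' : (0 : ℝ) < t := by exact_mod_cast ht0
  have htc : (t : ℝ) = ((n : ℝ) + 1) * q := by rw [ht]; push_cast; ring
  let P : Set (Fin n → ℝ) := (fun x => (t : ℝ)⁻¹ • (x + (-a))) '' S
  have hPc : IsCompact P := hc.image (by fun_prop)
  have hPv : Convex ℝ P := by
    have : P = (fun x => (t : ℝ)⁻¹ • x) '' ((fun x => -a + x) '' S) := by
      simp only [P, image_image, add_comm]
    rw [this]
    exact (hv.translate (-a)).linear_image (LinearMap.lsmul ℝ (Fin n → ℝ) (t : ℝ)⁻¹)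
  have hPne : P.Nonempty := hne.image _
  have hSP : S = (fun x => (t : ℝ) • x + a) '' P := by
    simp only [P, image_image, smul_smul, mul_inv_cancel₀ ht'.ne', one_smul, neg_add_cancel_right,
      image_id']
  rw [hH.toSetFunction_image hT ht0 a hPc hPv hPne hSP,
    toSetFunction_of_coe_eq V (coe_bodyOf P hPc hPv hPne), abs_mul, abs_of_pos (by positivity)]
  have hball : |V (bodyOf P hPc hPv hPne)| ≤ C := by
    refine hC _ ?_
    rw [coe_bodyOf]
    rintro x ⟨y, hy, hyx⟩
    rw [mem_closedBall_zero_iff]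
    have hxi : ∀ i, |x i| ≤ 1 / ((n : ℝ) + 1) := by
      intro i
      have h1 : x i = (t : ℝ)⁻¹ * (y i + -a i) := (congrFun hyx i).symm
      have h2 := (hS hy).1 i
      have h3 := (hS hy).2 i
      simp only at h3
      rw [h1, abs_of_nonneg (mul_nonneg (by positivity) (by linarith)), htc]
      calc (((n : ℝ) + 1) * q)⁻¹ * (y i + -a i) ≤ (((n : ℝ) + 1) * q)⁻¹ * q := by
            gcongr; linarith
        _ = 1 / ((n : ℝ) + 1) := by field_simp
    have hsq : ‖x‖ ^ 2 ≤ 1 := by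
      rw [EuclideanSpace.norm_sq_eq]
      calc ∑ i, ‖x i‖ ^ 2 ≤ ∑ _i : Fin n, (1 / ((n : ℝ) + 1)) ^ 2 :=
            Finset.sum_le_sum fun i _ => pow_le_pow_left₀ (norm_nonneg _) (hxi i) 2
        _ = n / ((n : ℝ) + 1) ^ 2 := by simp; field_simp
        _ ≤ 1 := by
          rw [div_le_one (by positivity)]
          nlinarith [(Nat.cast_nonneg n : (0 : ℝ) ≤ n)]
    nlinarith [norm_nonneg x]
  calc (t : ℝ) ^ n * |V (bodyOf P hPc hPv hPne)| ≤ (t : ℝ) ^ n * C := by gcongr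
    _ = ((n : ℝ) + 1) ^ n * C * (q : ℝ) ^ n := by rw [htc, mul_pow]; ring

lemma volume_real_cube {q : ℝ} (hq : 0 ≤ q) (a : Fin n → ℝ) :
    volume.real (Icc a (fun i => a i + q)) = q ^ n := by
  rw [measureReal_def, Real.volume_Icc_pi_toReal (fun i => by simpa using hq)]
  simp

lemma isCutAdditive_volume : IsCutAdditive (n := n) (fun S => volume.real S) := by
  intro S hc _ i a
  have hm : MeasurableSet (S ∩ {x | x i ≤ a}) :=
    hc.measurableSet.inter (isClosed_coord_le i a).measurableSet
  have h := measureReal_union_add_inter (μ := volume) (s := S ∩ {x | a ≤ x i}) hm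
    (measure_ne_top_of_subset inter_subset_left hc.measure_lt_top.ne)
    (measure_ne_top_of_subset inter_subset_left hc.measure_lt_top.ne)
  rw [← inter_union_distrib_left, ← inter_inter_distrib_left] at h
  rw [← h]
  congr 2
  · rw [inter_eq_left.2]
    exact fun x _ => le_total a (x i)
  · congr 2
    ext x
    exact ⟨fun hx : x i = a => ⟨hx.ge, hx.le⟩, fun hx => le_antisymm hx.2 hx.1⟩

/-- The difference of `V` and `V([0, 1]ⁿ)` times the volume vanishes on all cubes. -/
theorem IsWeaklyAdditive.isProportionalToVolume {V : Bodies n → ℝ} (hV : IsWeaklyAdditive V)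
    (hT : IsTranslationInvariant V) (hH : IsRatHomogeneous n V) (hB : IsBoundedOnUnitBall V) :
    IsProportionalToVolume V := by
  obtain ⟨C, hC⟩ := hB
  have hC0 : 0 ≤ C := (abs_nonneg _).trans (hC 0 (by simp))
  let c : ℝ := toSetFunction V (Icc 0 1)
  let G : Set (Fin n → ℝ) → ℝ := fun S => toSetFunction V S - c * volume.real S
  have hG : IsCutAdditive G := by
    intro S hSc hSv i a
    have h1 := hV.isCutAdditive S hSc hSv i a
    have h2 := isCutAdditive_volume S hSc hSv i a
    simp only [G]
    linear_combination h1 - c * h2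
  have hD : IsCubeBounded (((n : ℝ) + 1) ^ n * C + |c|) G := by
    intro q hq a S hSc hSv hS
    have hq' : (0 : ℝ) < q := by exact_mod_cast hq
    have h1 := hH.isCubeBounded hT hC0 hC q hq a S hSc hSv hS
    have h2 : volume.real S ≤ (q : ℝ) ^ n := by
      rw [← volume_real_cube hq'.le a]
      exact measureReal_mono hS isCompact_Icc.measure_lt_top.ne
    calc |G S| ≤ |toSetFunction V S| + |c * volume.real S| := abs_sub _ _
      _ = |toSetFunction V S| + |c| * volume.real S := by
        rw [abs_mul, abs_of_nonneg measureReal_nonneg]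
      _ ≤ ((n : ℝ) + 1) ^ n * C * (q : ℝ) ^ n + |c| * (q : ℝ) ^ n := by gcongr
      _ = _ := by ring
  have hcube : ∀ q : ℚ, 0 < q → ∀ a : Fin n → ℝ, G (Icc a (fun i => a i + q)) = 0 := by
    intro q hq a
    have hq' : (0 : ℝ) < q := by exact_mod_cast hq
    simp only [G]
    rw [hH.toSetFunction_image hT hq a isCompact_Icc (convex_Icc 0 1)
      (nonempty_Icc.2 zero_le_one) (Icc_eq_image_unitCube hq a), volume_real_cube hq'.le a]
    ring
  refine ⟨c, fun K => ?_⟩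
  let S : Set (Fin n → ℝ) := WithLp.toLp 2 ⁻¹' (K : Set (Eucl n))
  have hKS : (K : Set (Eucl n)) = WithLp.ofLp ⁻¹' S := rfl
  have hSc : IsCompact S :=
    (EuclideanSpace.equiv (Fin n) ℝ).symm.toHomeomorph.isCompact_preimage.2 K.isCompact
  have hSv : Convex ℝ S :=
    K.convex.linear_preimage (EuclideanSpace.equiv (Fin n) ℝ).symm.toLinearMap
  have hzero := hG.eq_zero hD (by simp [G, toSetFunction_empty]) hcube hSc hSv
  have hvol : (volume (K : Set (Eucl n))).toReal = volume.real S := by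
    rw [hKS, (PiLp.volume_preserving_ofLp (Fin n)).measure_preimage
      hSc.measurableSet.nullMeasurableSet, measureReal_def]
  simp only [G, toSetFunction_of_coe_eq V hKS] at hzero
  rw [hvol]
  linarith

lemma IsHomogeneous.isRatHomogeneous {m : ℕ} {V : Bodies n → ℝ} (hV : IsHomogeneous m V) :
    IsRatHomogeneous m V :=
  fun q hq K => hV q (by exact_mod_cast hq) K

lemma IsValuation.isWeaklyAdditive {V : Bodies n → ℝ} (hV : IsValuation V) :
    IsWeaklyAdditive V := by
  intro u a _ K K₀ Kp Km h0 hp hm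
  refine hV Kp Km K K₀ ?_ ?_
  · rw [hp, hm, ← inter_union_distrib_left, inter_eq_left.2]
    exact fun x _ => le_total a (inner ℝ u x)
  · rw [h0, hp, hm, ← inter_inter_distrib_left]
    congr 1
    ext x
    exact ⟨fun hx : inner ℝ u x = a => ⟨hx.ge, hx.le⟩, fun hx => le_antisymm hx.2 hx.1⟩

end BodyFunctional

theorem theorem1p1 (n : ℕ) :
    -- every valuation is weakly additive
    (∀ V : Bodies n → ℝ, BodyFunctional.IsValuation V → BodyFunctional.IsWeaklyAdditive V) ∧
    -- the characterization of volume
    (∀ V : Bodies n → ℝ,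
      BodyFunctional.IsWeaklyAdditive V →
      BodyFunctional.IsTranslationInvariant V →
      BodyFunctional.IsHomogeneous n V →
      BodyFunctional.IsBoundedOnUnitBall V →
      BodyFunctional.IsProportionalToVolume V) ∧
    -- homogeneity for rational factors is enough
    (∀ V : Bodies n → ℝ,
      BodyFunctional.IsWeaklyAdditive V →
      BodyFunctional.IsTranslationInvariant V →
      BodyFunctional.IsRatHomogeneous n V →
      BodyFunctional.IsBoundedOnUnitBall V →
      BodyFunctional.IsProportionalToVolume V) := by
  exact ⟨fun V hV => hV.isWeaklyAdditive,
    fun V hV hT hH hB => hV.isProportionalToVolume hT hH.isRatHomogeneous hB,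
    fun V hV hT hH hB => hV.isProportionalToVolume hT hH hB⟩
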